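/- Consider the two-dimensional incompressible Navier--Stokes equations on $[0,2\pi]^2$ with periodic boundary conditions, zero mean and viscosity $1$, in functional form $$\frac{du}{dt}+Au+B(u,u)=g\qquad(\ast)$$ in the real Hilbert space $H$ of vector fields $u(x)=\sum_{k\in\mathbb Z^2\setminus\{0\}}\hat u(k)e^{ik\cdot x}$ with $\hat u(k)\in\mathbb C^2$, $\overline{\hat u(k)}=\hat u(-k)$, $k\cdot\hat u(k)=0$, $\sum_k|\hat u(k)|^2<\infty$, with the $L^2([0,2\pi]^2)^2$ scalar product. Here $A$ is the Stokes operator, $\widehat{Au}(k)=|k|^2\hat u(k)$, with domain $D(A)=\{u\in H:\sum_k|k|^4|\hat u(k)|^2<\infty\}$, and, for $u,v\in D(A)$ and $k\neq0$, $$\hat B(u,v)(k)=i\sum_{j\in\mathbb Z^2\setminus\{0\}}\Big[(\hat u(k-j)\cdot j)\,\hat v(j)-\frac{(\hat u(k-j)\cdot j)(\hat v(j)\cdot k)}{|k|^2}\,k\Big],$$ where $a\cdot b=a_1b_1+a_2b_2$ and $\hat u(0)=0$. Let $\lambda>1$ and let $g\in D(A)$ satisfy $Ag=\lambda g$. The global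 attractor $\mathcal A$ is the set of all $u_0\in H$ for which there is a solution $u$ of $(\ast)$ on $\mathbb R$ (that is, $u:\mathbb R\to H$ is differentiable, $u(t)\in D(A)$, and $(\ast)$ holds for all $t\in\mathbb R$) with $u(0)=u_0$ and $\sup_{t\in\mathbb R}|u(t)|<\infty$. A ghost solution is a non-constant solution $u$ of $(\ast)$ on $\mathbb R$, with $u(t)\in\mathcal A$ for all $t$, such that $$\frac{d}{dt}|u(t)|^2=\frac{d}{dt}|A^{1/2}u(t)|^2=0\quad\text{for all }t\in\mathbb R.$$ It is chained if there are real constants $\gamma,\beta,\alpha$ such that $u(t)\in D(A^2)$ and $$A^2u(t)=\gamma g+\beta u(t)+\alpha Au(t)\quad\text{for all }t\in\mathbb R.$$ **Theorem.** Let $u$ be a chained ghost solution, let $\gamma,\beta,\alpha$ be any constants as in the chained relation, and let $\mu_\pm=\frac12\big(\alpha\pm\sqrt{\alpha^2+4\beta}\big)$. Then $\alpha^2+4\beta>0$ and $\mu_-<\lambda<\mu_+$, and $u$ satisfies the following finite Galerkin system. For every $k\in\mathbb Z^2$ with $|k|^2\in\{\lambda,\mu_+,\mu_-\}$ and every $t\in\mathbb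 R$, $$\frac{d}{dt}\hat u(k,t)=\hat g(k)-|k|^2\hat u(k,t)-\Big[Q_k(\hat u,\hat u)-\frac{Q_k(\hat u,\hat u)\cdot k}{|k|^2}\,k\Big],$$ where $$Q_k(\hat u,\hat u)=\sum_{\substack{h\in\mathbb Z^2\setminus\{0\}\\ |h|^2,\,|k-h|^2\in\{\lambda,\mu_+,\mu_-\}}}i\,(\hat u(h,t)\cdot k)\,\hat u(k-h,t).$$ Moreover $\hat u(k,t)=0$ for all $t\in\mathbb R$ if $|k|^2\notin\{\lambda,\mu_+,\mu_-\}$, and $\hat g(k)=0$ if $|k|^2\neq\lambda$. -/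

import Mathlib

/-!
Two-dimensional, space-periodic, incompressible Navier-Stokes equations on `[0, 2π]²` with unit
viscosity, in functional form `du/dt + A u + B(u, u) = g`. A velocity field
`u(x) = ∑ k, û(k) exp(i k · x)` is given by its Fourier coefficients `û(k) ∈ ℂ²`, `k ∈ ℤ²`.
-/

namespace GhostNSE

open scoped ENNReal

noncomputable section

/-- Wave vectors. -/
abbrev Mode : Type := Fin 2 → ℤ

/-- The space `ℂ²` of the Fourier coefficients, with its Hermitian norm. -/
abbrev C2 : Type := EuclideanSpace ℂ (Fin 2)

/-- `|k|² = k · k`, as a real number. -/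
def normSq (k : Mode) : ℝ := ∑ i, (k i : ℝ) ^ 2

/-- The wave vector `k` as an element of `ℂ²`. -/
def modeVec (k : Mode) : C2 := WithLp.toLp 2 (fun i => (k i : ℂ))

/-- The bilinear (not sesquilinear) product `a · b = a₁ b₁ + a₂ b₂` on `ℂ²`. -/
def dot (a b : C2) : ℂ := ∑ i, a i * b i

/-- The phase space `H`: square-summable families of Fourier coefficients of real-valued,
mean-zero, divergence-free vector fields. The norm inherited from `ℓ²(ℤ²; ℂ²)` is the
`[L²([0, 2π]²)]²` norm divided by `2π`. -/
def PhaseSpace : Submodule ℝ (lp (fun _ : Mode => C2) 2) where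
  carrier := {u | u 0 = 0 ∧ (∀ k i, star (u k i) = u (-k) i) ∧ ∀ k, dot (modeVec k) (u k) = 0}
  zero_mem' := by simp [dot]
  add_mem' := by
    rintro u v ⟨hu0, hur, hud⟩ ⟨hv0, hvr, hvd⟩
    refine ⟨by simp [hu0, hv0], fun k i => ?_, fun k => ?_⟩
    · simpa using congrArg₂ (· + ·) (hur k i) (hvr k i)
    · simpa [dot, mul_add, Finset.sum_add_distrib, add_add_add_comm] using
        congrArg₂ (· + ·) (hud k) (hvd k)
  smul_mem' := by
    rintro c u ⟨hu0, hur, hud⟩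
    refine ⟨by simp [hu0], fun k i => ?_, fun k => ?_⟩
    · simpa using congrArg (fun z : ℂ => (c : ℂ) * z) (hur k i)
    · have h := congrArg (fun z : ℂ => (c : ℂ) * z) (hud k)
      simpa [dot, mul_add, mul_left_comm] using h

/-- The Fourier coefficient `û(k)`. -/
def coeff (u : PhaseSpace) (k : Mode) : C2 := (u : lp (fun _ : Mode => C2) 2) k

theorem summable_iff_memlp (u : PhaseSpace) :
    Summable (fun k => normSq k ^ 2 * ‖coeff u k‖ ^ 2) ↔
      Memℓp (fun k => normSq k • coeff u k) 2 := by
  rw [memℓp_gen_iff (by norm_num)]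
  simp [norm_smul, mul_pow]

/-- The domain `D(A) = {u ∈ H : ∑ (k · k)² |û(k)|² < ∞}` of the Stokes operator. -/
def stokesDomain : Submodule ℝ PhaseSpace where
  carrier := {u | Summable (fun k => normSq k ^ 2 * ‖coeff u k‖ ^ 2)}
  zero_mem' := by
    have h : ∀ k, coeff 0 k = 0 := fun _ => rfl
    simp [h, summable_zero]
  add_mem' := by
    intro u v hu hv
    simp only [Set.mem_ofPred_eq, summable_iff_memlp] at hu hv ⊢
    have h : (fun k => normSq k • coeff (u + v) k) =
        (fun k => normSq k • coeff u k) + fun k => normSq k • coeff v k := by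
      funext k
      exact smul_add (normSq k) (coeff u k) (coeff v k)
    rw [h]
    exact hu.add hv
  smul_mem' := by
    intro c u hu
    simp only [Set.mem_ofPred_eq, summable_iff_memlp] at hu ⊢
    have h : (fun k => normSq k • coeff (c • u) k) = c • fun k => normSq k • coeff u k := by
      funext k
      exact smul_comm (normSq k) c (coeff u k)
    rw [h]
    exact hu.const_smul c

/-- The value `A u`, with coefficients `(k · k) û(k)`, for `u ∈ D(A)`. -/
def stokesFun (u : stokesDomain) : PhaseSpace :=
  ⟨⟨fun k => normSq k • coeff u k, (summable_iff_memlp u).1 u.2⟩, by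
    obtain ⟨h0, hr, hd⟩ := u.1.2
    refine ⟨?_, fun k i => ?_, fun k => ?_⟩
    · change normSq 0 • coeff u 0 = 0
      rw [show coeff u 0 = 0 from h0, smul_zero]
    · change star ((normSq k • coeff u k) i) = (normSq (-k) • coeff u (-k)) i
      have hk : normSq (-k) = normSq k := by simp [normSq]
      have h : star (coeff u k i) = coeff u (-k) i := hr k i
      rw [hk, PiLp.smul_apply, PiLp.smul_apply, ← h]
      simp
    · change dot (modeVec k) (normSq k • coeff u k) = 0
      have h : dot (modeVec k) (coeff u k) = 0 := hd k
      have h2 := congrArg (fun z : ℂ => (normSq k : ℂ) * z) h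
      simpa [dot, mul_add, mul_left_comm] using h2⟩

/-- The Stokes operator `A`, as an unbounded operator in `H`. -/
def stokes : PhaseSpace →ₗ.[ℝ] PhaseSpace where
  domain := stokesDomain
  toFun :=
    { toFun := stokesFun
      map_add' := by
        intro u v
        apply Subtype.ext
        apply Subtype.ext
        funext k
        exact smul_add (normSq k) (coeff u k) (coeff v k)
      map_smul' := by
        intro c u
        apply Subtype.ext
        apply Subtype.ext
        funext k
        exact smul_comm (normSq k) c (coeff u k) }

/-- The Fourier coefficient of the bilinear term (for `u, v ∈ D(A)` the series converges
absolutely):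
`B(u, v)^(k) = i ∑_{j ≠ 0} [(û(k-j) · j) v̂(j) - ((û(k-j) · j) (v̂(j) · k) / (k · k)) k]`. -/
def bilinCoeff (u v : PhaseSpace) (k : Mode) : C2 :=
  Complex.I • ∑' j : {j : Mode // j ≠ 0},
    (dot (coeff u (k - j)) (modeVec j) • coeff v j -
      (dot (coeff u (k - j)) (modeVec j) * dot (coeff v j) (modeVec k) / (normSq k : ℂ)) •
        modeVec k)

/-- The energy `|u|² = (u, u)`, where `(u, v) = ∫ u · v` over `[0, 2π]²`, written by Parseval's
identity. -/
def energy (u : PhaseSpace) : ℝ := (2 * Real.pi) ^ 2 * ∑' k, ‖coeff u k‖ ^ 2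

/-- The enstrophy `‖u‖² = |A^{1/2} u|²`, for `u ∈ V = D(A^{1/2})`. -/
def enstrophy (u : PhaseSpace) : ℝ := (2 * Real.pi) ^ 2 * ∑' k, normSq k * ‖coeff u k‖ ^ 2

/-- `u` is a solution on the whole of `ℝ` of `du/dt + A u + B(u, u) = g`: for all `t`,
`u(t) ∈ D(A)`, `u` is differentiable at `t` as an `H`-valued function, and the equation holds
(as an identity between the Fourier coefficients, which determine an element of `H`). -/
def IsSolution (g : PhaseSpace) (u : ℝ → PhaseSpace) : Prop :=
  ∀ t, ∃ ht : u t ∈ stokes.domain, ∃ w : PhaseSpace, HasDerivAt u w t ∧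
    ∀ k : Mode, k ≠ 0 →
      coeff w k + coeff (stokes ⟨u t, ht⟩) k + bilinCoeff (u t) (u t) k = coeff g k

/-- The global attractor: the set of all `u₀ ∈ H` through which there passes, at time `0`, a
solution on `ℝ` that is bounded in `H`. -/
def attractor (g : PhaseSpace) : Set PhaseSpace :=
  {u₀ | ∃ u : ℝ → PhaseSpace, IsSolution g u ∧ u 0 = u₀ ∧ ∃ C : ℝ, ∀ t, ‖u t‖ ≤ C}

/-- A ghost solution: a nonstationary solution in the attractor whose energy and enstrophy have
zero time derivative. -/
structure IsGhost (g : PhaseSpace) (u : ℝ → PhaseSpace) : Prop where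
  isSolution : IsSolution g u
  mem_attractor : ∀ t, u t ∈ attractor g
  nonstationary : ¬ ∃ v : PhaseSpace, ∀ t, u t = v
  energy_deriv : ∀ t, HasDerivAt (fun s => energy (u s)) 0 t
  enstrophy_deriv : ∀ t, HasDerivAt (fun s => enstrophy (u s)) 0 t

/-- The chained relation `A² u(t) = γ g + β u(t) + α A u(t)` for all `t`, with
`u(t) ∈ D(A²)`, that is, `u(t) ∈ D(A)` and `A u(t) ∈ D(A)`. -/
def ChainRelation (g : PhaseSpace) (u : ℝ → PhaseSpace) (γ β α : ℝ) : Prop :=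
  ∀ t, ∃ (h₁ : u t ∈ stokes.domain) (h₂ : stokes ⟨u t, h₁⟩ ∈ stokes.domain),
    stokes ⟨stokes ⟨u t, h₁⟩, h₂⟩ = γ • g + β • u t + α • stokes ⟨u t, h₁⟩

/-- A chained ghost solution. -/
def IsChainedGhost (g : PhaseSpace) (u : ℝ → PhaseSpace) : Prop :=
  IsGhost g u ∧ ∃ γ β α : ℝ, ChainRelation g u γ β α

/-- `μ₊`, the larger root of `μ² - α μ - β`. -/
def muPlus (β α : ℝ) : ℝ := (α + Real.sqrt (α ^ 2 + 4 * β)) / 2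

/-- `μ₋`, the smaller root of `μ² - α μ - β`. -/
def muMinus (β α : ℝ) : ℝ := (α - Real.sqrt (α ^ 2 + 4 * β)) / 2

/-- The set `{λ, μ₊, μ₋}` of the active shells. -/
def shells (lam β α : ℝ) : Finset ℝ := {lam, muPlus β α, muMinus β α}

/-- Only finitely many wave vectors lie on a shell `|h|² = r`, `r` in a finite set. -/
theorem finite_shell (S : Finset ℝ) : {h : Mode | normSq h ∈ S}.Finite := by
  obtain ⟨M, hM⟩ := S.bddAbove
  refine (Set.finite_Icc (fun _ : Fin 2 => -⌈|M|⌉ - 1) (fun _ : Fin 2 => ⌈|M|⌉ + 1)).subset ?_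
  intro h hh
  have h1 : normSq h ≤ |M| := (hM hh).trans (le_abs_self M)
  have key : ∀ i, |h i| ≤ ⌈|M|⌉ := by
    intro i
    have h2 : ((h i : ℝ)) ^ 2 ≤ normSq h :=
      Finset.single_le_sum (f := fun i => (h i : ℝ) ^ 2) (fun j _ => sq_nonneg _)
        (Finset.mem_univ i)
    have h3 : |h i| ≤ h i ^ 2 := by
      rw [← sq_abs]
      have := abs_nonneg (h i)
      nlinarith [Int.le_self_sq |h i|]
    have h4 : ((|h i| : ℤ) : ℝ) ≤ ((⌈|M|⌉ : ℤ) : ℝ) := by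
      have h5 : ((|h i| : ℤ) : ℝ) ≤ (h i : ℝ) ^ 2 := by exact_mod_cast h3
      exact (h5.trans (h2.trans h1)).trans (Int.le_ceil _)
    exact_mod_cast h4
  rw [Set.mem_Icc]
  refine ⟨fun i => ?_, fun i => ?_⟩
  · have := abs_le.1 (key i)
    simp only
    omega
  · have := abs_le.1 (key i)
    simp only
    omega

/-- The finite set `{h ∈ ℤ² ∖ {0} : |h|² ∈ S, |k - h|² ∈ S}` of interacting wave vectors. -/
def interactions (S : Finset ℝ) (k : Mode) : Finset Mode :=
  ((finite_shell S).subset (fun _ (hh : _ ∧ _ ∧ _) => hh.2.1) :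
    {h : Mode | h ≠ 0 ∧ normSq h ∈ S ∧ normSq (k - h) ∈ S}.Finite).toFinset

/-- `Q_k(û, û) = ∑ i (û(h) · k) û(k - h)`, the sum over the wave vectors `h ≠ 0` with `|h|²` and
`|k - h|²` in `S`. -/
def galerkinQ (S : Finset ℝ) (u : PhaseSpace) (k : Mode) : C2 :=
  ∑ h ∈ interactions S k,
    (Complex.I * dot (coeff u h) (modeVec k)) • coeff u (k - h)

end

end GhostNSE

open scoped ComplexConjugate

namespace GhostNSE

/-! Off the shell `|k|² = λ` the forcing vanishes, so the chained relation makes `|k|²` a root of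
`μ² - α μ - β` wherever `û(k) ≠ 0` (`chain_root`). Hence `u` lives on at most three shells, all sums
are finite, and substituting `j = k - h` in the bilinear term gives the Galerkin system
(`bilinCoeff_eq_galerkin`).

For the position of `λ`, differentiate enstrophy minus `λ` times energy. The forcing cancels because
`Ag = λg`, the nonlinearity because `(B(u,u),u) = (B(u,u),Au) = 0`; what remains is `∑ (|k|² -
λ)|k|²|û(k)|² = 0` (`ghost_balance`). On a single shell the nonlinear term vanishes, so `u` would be
a bounded entire solution of a linear damped equation, hence constant. A ghost therefore has, at
some time, an active mode off the shell `λ`; the balance then provides active modes on both sides of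
`λ`, whose `|k|²` are two distinct roots. -/

/-! ### Stream function coordinates -/

/-- The scalar cross product `l₁ k₂ - l₂ k₁` of two wave vectors. -/
def cross (l k : Mode) : ℂ := (l 0 : ℂ) * k 1 - (l 1 : ℂ) * k 0

/-- The scalar product of `a ∈ ℂ²` with `k^⊥ = (-k₂, k₁)`. -/
def perpDot (k : Mode) (a : C2) : ℂ := -(k 1 : ℂ) * a 0 + (k 0 : ℂ) * a 1

/-- The scalar `c(k)` with `û(k) = c(k) k^⊥` (a multiple of the Fourier coefficient of the stream
function). -/
noncomputable def stream (u : PhaseSpace) (k : Mode) : ℂ := perpDot k (coeff u k) / normSq k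

theorem normSq_eq (k : Mode) : normSq k = (k 0 : ℝ) ^ 2 + (k 1 : ℝ) ^ 2 := by
  simp [normSq, Fin.sum_univ_two]

theorem ofReal_normSq (k : Mode) : (normSq k : ℂ) = (k 0 : ℂ) ^ 2 + (k 1 : ℂ) ^ 2 := by
  rw [normSq_eq]; push_cast; ring

theorem normSq_neg (k : Mode) : normSq (-k) = normSq k := by simp [normSq]

theorem normSq_pos {k : Mode} (hk : k ≠ 0) : 0 < normSq k := by
  refine lt_of_le_of_ne (Finset.sum_nonneg fun _ _ => sq_nonneg _) fun h => hk ?_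
  rw [normSq_eq] at h
  have h0 : (k 0 : ℝ) = 0 := by nlinarith [sq_nonneg (k 0 : ℝ), sq_nonneg (k 1 : ℝ)]
  have h1 : (k 1 : ℝ) = 0 := by nlinarith [sq_nonneg (k 0 : ℝ), sq_nonneg (k 1 : ℝ)]
  funext i
  fin_cases i
  · exact_mod_cast h0
  · exact_mod_cast h1

theorem normSq_ne_zero {k : Mode} (hk : k ≠ 0) : (normSq k : ℂ) ≠ 0 :=
  Complex.ofReal_ne_zero.2 (normSq_pos hk).ne'

theorem dot_eq (a b : C2) : dot a b = a 0 * b 0 + a 1 * b 1 := by simp [dot, Fin.sum_univ_two]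

theorem modeVec_apply (k : Mode) (i : Fin 2) : modeVec k i = k i := rfl

theorem coeff_zero (u : PhaseSpace) : coeff u 0 = 0 := u.2.1

theorem conj_coeff (u : PhaseSpace) (k : Mode) (i : Fin 2) :
    conj (coeff u k i) = coeff u (-k) i := u.2.2.1 k i

theorem div_free (u : PhaseSpace) (k : Mode) :
    (k 0 : ℂ) * coeff u k 0 + (k 1 : ℂ) * coeff u k 1 = 0 := by
  have h : dot (modeVec k) (coeff u k) = 0 := u.2.2.2 k
  simpa [dot_eq, modeVec_apply] using h

theorem stream_zero (u : PhaseSpace) : stream u 0 = 0 := by simp [stream, perpDot]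

theorem perpDot_coeff (u : PhaseSpace) (k : Mode) :
    perpDot k (coeff u k) = normSq k * stream u k := by
  by_cases hk : k = 0
  · simp [hk, perpDot, stream_zero]
  · rw [stream, mul_div_cancel₀ _ (normSq_ne_zero hk)]

/-- Since `û(k)` is orthogonal to `k`, only its `k^⊥` component survives; `k = 0` is separate
because `stream` divides by `|k|²`. -/
theorem coeff_apply_zero (u : PhaseSpace) (k : Mode) : coeff u k 0 = -(k 1 : ℂ) * stream u k := by
  by_cases hk : k = 0
  · simp [hk, coeff_zero]
  have hn := normSq_ne_zero hk
  have h := perpDot_coeff u k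
  apply mul_left_cancel₀ hn
  rw [ofReal_normSq] at *
  rw [perpDot] at h
  linear_combination (k 0 : ℂ) * div_free u k - (k 1 : ℂ) * h

theorem coeff_apply_one (u : PhaseSpace) (k : Mode) : coeff u k 1 = (k 0 : ℂ) * stream u k := by
  by_cases hk : k = 0
  · simp [hk, coeff_zero]
  have hn := normSq_ne_zero hk
  have h := perpDot_coeff u k
  apply mul_left_cancel₀ hn
  rw [ofReal_normSq] at *
  rw [perpDot] at h
  linear_combination (k 1 : ℂ) * div_free u k + (k 0 : ℂ) * h

theorem stream_eq_zero_of_coeff {u : PhaseSpace} {k : Mode} (h : coeff u k = 0) :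
    stream u k = 0 := by
  simp [stream, perpDot, h]

theorem coeff_eq_of_stream_eq {u v : PhaseSpace} {k : Mode} (h : stream u k = stream v k) :
    coeff u k = coeff v k := by
  ext i
  fin_cases i
  · simp [coeff_apply_zero, h]
  · simp [coeff_apply_one, h]

theorem stream_neg (u : PhaseSpace) (k : Mode) : stream u (-k) = -conj (stream u k) := by
  simp only [stream, perpDot, ← conj_coeff, normSq_neg, map_div₀, map_add, map_mul, map_neg,
    Complex.conj_ofReal, map_intCast, Pi.neg_apply, Int.cast_neg]
  ring

theorem dot_coeff (u : PhaseSpace) (h k : Mode) :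
    dot (coeff u h) (modeVec k) = stream u h * cross h k := by
  rw [dot_eq, coeff_apply_zero, coeff_apply_one, modeVec_apply, modeVec_apply, cross]
  ring

theorem norm_coeff_sq (u : PhaseSpace) (k : Mode) :
    ‖coeff u k‖ ^ 2 = normSq k * ‖stream u k‖ ^ 2 := by
  rw [EuclideanSpace.norm_sq_eq, Fin.sum_univ_two, coeff_apply_zero, coeff_apply_one]
  simp only [norm_mul, norm_neg, Complex.norm_intCast, mul_pow, sq_abs, normSq_eq]
  ring

/-- Makes the modulus bilinear in the stream coefficients, ready for the product rule and the
trilinear identities. -/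
theorem ofReal_norm_stream_sq (u : PhaseSpace) (k : Mode) :
    ((‖stream u k‖ ^ 2 : ℝ) : ℂ) = -(stream u k * stream u (-k)) := by
  rw [stream_neg, mul_neg, neg_neg, Complex.mul_conj, Complex.normSq_eq_norm_sq]

/-! ### Symmetries of the quadratic term -/

/-- The quadratic term of the stream function equation, multiplied by `|k|²` and by `-i`. -/
noncomputable def transport (c : Mode → ℂ) (k : Mode) : ℂ :=
  ∑' h, c h * c (k - h) * cross h k * normSq (k - h)

theorem cross_sub_self (h k : Mode) : cross (k - h) k = -cross h k := by
  simp [cross]; ring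

theorem eq_zero_of_eq_neg {z : ℂ} (h : z = -z) : z = 0 := self_eq_neg.1 h

/-- A term of the symmetrised quadratic term that is odd under `h ↦ k - h` sums to zero. -/
theorem tsum_eq_zero_of_odd {α : Type*} (e : α ≃ α) {F : α → ℂ} (hF : ∀ p, F (e p) = -F p) :
    ∑' p, F p = 0 := by
  apply eq_zero_of_eq_neg
  -- Reindexing and negation of `tsum` need no summability.
  conv_lhs => rw [← e.tsum_eq F]
  simp_rw [hF, tsum_neg]

/-- On one shell the factor `|k - h|²` is constant, while the cross product is odd under `h ↦ k -
h`. -/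
theorem transport_eq_zero_of_shell {c : Mode → ℂ} {r : ℝ} (hc : ∀ k, normSq k ≠ r → c k = 0)
    (k : Mode) : transport c k = 0 := by
  refine tsum_eq_zero_of_odd (Equiv.subLeft k) fun h => ?_
  simp only [Equiv.subLeft_apply, sub_sub_cancel, cross_sub_self]
  by_cases h1 : normSq h = r
  · by_cases h2 : normSq (k - h) = r
    · rw [h1, h2]; ring
    · rw [hc _ h2]; ring
  · rw [hc _ h1]; ring

variable {c : Mode → ℂ} {T : Finset Mode}

theorem transport_eq_sum (hc : ∀ k ∉ T, c k = 0) (k : Mode) :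
    transport c k = ∑ h ∈ T, c h * c (k - h) * cross h k * normSq (k - h) :=
  tsum_eq_sum fun h hh => by rw [hc h hh]; ring

/-- Summing over all pairs lets the symmetries below act without preserving `T ×ˢ T`. -/
theorem sum_transport_eq_tsum (hc : ∀ k ∉ T, c k = 0) (hT : ∀ k ∈ T, -k ∈ T) (w : Mode → ℂ) :
    ∑ k ∈ T, w k * transport c k * c (-k) =
      ∑' p : Mode × Mode,
        w p.1 * (c p.2 * c (p.1 - p.2) * cross p.2 p.1 * normSq (p.1 - p.2)) * c (-p.1) := by
  rw [tsum_eq_sum (s := T ×ˢ T), Finset.sum_product]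
  · refine Finset.sum_congr rfl fun k _ => ?_
    rw [transport_eq_sum hc, Finset.mul_sum, Finset.sum_mul]
  · rintro ⟨k, h⟩ hp
    rw [Finset.mem_product, not_and_or] at hp
    rcases hp with hp | hp
    · rw [hc (-k) fun h => hp (by simpa using hT _ h)]; ring
    · rw [hc _ hp]; ring

/-- Orthogonality `(B(u, u), u) = 0`. -/
theorem sum_transport (hc : ∀ k ∉ T, c k = 0) (hT : ∀ k ∈ T, -k ∈ T) :
    ∑ k ∈ T, transport c k * c (-k) = 0 := by
  have h := sum_transport_eq_tsum hc hT (fun _ => 1)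
  simp only [one_mul] at h
  rw [h]
  -- The involution `(k, h) ↦ (-h, -k)` fixes `k - h` and reverses the cross product.
  refine tsum_eq_zero_of_odd ((Equiv.prodComm _ _).trans
    (Equiv.prodCongr (Equiv.neg _) (Equiv.neg _))) ?_
  rintro ⟨k, h⟩
  have h1 : -h - -k = k - h := by abel
  simp only [Equiv.trans_apply, Equiv.prodComm_apply, Prod.swap_prod_mk, Equiv.prodCongr_apply,
    Prod.map_apply, Equiv.neg_apply, h1, neg_neg]
  simp only [cross, Pi.neg_apply, Int.cast_neg]
  ring

/-- Orthogonality `(B(u, u), A u) = 0`. -/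
theorem sum_normSq_transport (hc : ∀ k ∉ T, c k = 0) (hT : ∀ k ∈ T, -k ∈ T) :
    ∑ k ∈ T, (normSq k : ℂ) * transport c k * c (-k) = 0 := by
  rw [sum_transport_eq_tsum hc hT (fun k => (normSq k : ℂ))]
  -- This involution exchanges `-k` and `k - h`, hence the weights `|k|²` and `|k - h|²`.
  let e : Mode × Mode ≃ Mode × Mode :=
    ⟨fun p => (p.2 - p.1, p.2), fun p => (p.2 - p.1, p.2), fun p => by simp, fun p => by simp⟩
  refine tsum_eq_zero_of_odd e ?_
  rintro ⟨k, h⟩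
  have h1 : h - k - h = -k := by abel
  simp only [e, Equiv.coe_fn_mk, h1, neg_sub, normSq_neg]
  rw [← neg_sub k h, normSq_neg]
  simp only [cross, Pi.neg_apply, Pi.sub_apply, Int.cast_neg, Int.cast_sub]
  ring

/-! ### Bilinear term on finitely many shells -/

theorem mem_interactions {S : Finset ℝ} {k h : Mode} :
    h ∈ interactions S k ↔ h ≠ 0 ∧ normSq h ∈ S ∧ normSq (k - h) ∈ S := by
  simp [interactions]

theorem dot_sum_smul {ι : Type*} (s : Finset ι) (z : ι → ℂ) (a : ι → C2) (b : C2) :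
    dot (∑ i ∈ s, z i • a i) b = ∑ i ∈ s, z i * dot (a i) b := by
  simp only [dot_eq, WithLp.ofLp_sum, WithLp.ofLp_smul, Finset.sum_apply, Pi.smul_apply,
    smul_eq_mul, Finset.sum_mul, ← Finset.sum_add_distrib]
  exact Finset.sum_congr rfl fun _ _ => by ring

theorem perpDot_sum_smul {ι : Type*} (s : Finset ι) (z : ι → ℂ) (a : ι → C2) (k : Mode) :
    perpDot k (∑ i ∈ s, z i • a i) = ∑ i ∈ s, z i * perpDot k (a i) := by
  simp only [perpDot, WithLp.ofLp_sum, WithLp.ofLp_smul, Finset.sum_apply, Pi.smul_apply,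
    smul_eq_mul, Finset.mul_sum, ← Finset.sum_add_distrib]
  exact Finset.sum_congr rfl fun _ _ => by ring

theorem coeff_eq_zero_or {S : Finset ℝ} {u : PhaseSpace}
    (hu : ∀ k, normSq k ∉ S → coeff u k = 0) {k h : Mode} (hh : h ∉ interactions S k) :
    coeff u h = 0 ∨ coeff u (k - h) = 0 := by
  by_contra! hne
  refine hh (mem_interactions.2 ⟨?_, ?_, ?_⟩)
  · rintro rfl
    exact hne.1 (coeff_zero u)
  · by_contra h1
    exact hne.1 (hu _ h1)
  · by_contra h1
    exact hne.2 (hu _ h1)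

/-- The bilinear term of a field supported on finitely many shells, in Galerkin form. -/
theorem bilinCoeff_eq_galerkin {S : Finset ℝ} {u : PhaseSpace}
    (hu : ∀ k, normSq k ∉ S → coeff u k = 0) (k : Mode) :
    bilinCoeff u u k = galerkinQ S u k -
      (dot (galerkinQ S u k) (modeVec k) / (normSq k : ℂ)) • modeVec k := by
  have h₀ : ∀ a : C2, dot 0 a = 0 := fun a => by simp [dot]
  let f : Mode → C2 := fun j => dot (coeff u (k - j)) (modeVec j) • coeff u j -
    (dot (coeff u (k - j)) (modeVec j) * dot (coeff u j) (modeVec k) / (normSq k : ℂ)) • modeVec k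
  have hf : ∑' j : {j : Mode // j ≠ 0}, f j = ∑' j, f j := by
    refine tsum_subtype_eq_of_support_subset (s := {j : Mode | j ≠ 0}) fun j hj => ?_
    rintro rfl
    exact hj (by simp [f, coeff_zero, h₀])
  change Complex.I • ∑' j : {j : Mode // j ≠ 0}, f j = _
  rw [hf]
  rw [← (Equiv.subLeft k).tsum_eq, tsum_eq_sum (s := interactions S k)]
  swap
  · intro h hh
    rcases coeff_eq_zero_or hu hh with h1 | h1 <;> simp [f, h1, h₀]
  rw [galerkinQ, dot_sum_smul, Finset.sum_div, Finset.sum_smul, ← Finset.sum_sub_distrib,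
    Finset.smul_sum]
  refine Finset.sum_congr rfl fun h _ => ?_
  -- Incompressibility: `û(h) · h = 0`.
  have h1 : dot (coeff u h) (modeVec (k - h)) = dot (coeff u h) (modeVec k) := by
    rw [dot_coeff, dot_coeff]
    simp [cross]
    ring_nf
    simp
  simp only [f]
  rw [Equiv.subLeft_apply, sub_sub_cancel, h1, smul_sub, smul_smul, smul_smul]
  congr 2
  ring

/-- Pairing with `k^⊥` removes the pressure term and leaves the weight `k · (k - h) = |k - h|² + h ·
(k - h)`. The last product is even under `h ↦ k - h`, so its contribution `F` cancels. -/
theorem perpDot_bilinCoeff {S : Finset ℝ} {u : PhaseSpace}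
    (hu : ∀ k, normSq k ∉ S → coeff u k = 0) (k : Mode) :
    perpDot k (bilinCoeff u u k) = Complex.I * transport (stream u) k := by
  have hz : ∀ h ∉ interactions S k, stream u h * stream u (k - h) = 0 := fun h hh => by
    rcases coeff_eq_zero_or hu hh with h1 | h1 <;> simp [stream_eq_zero_of_coeff h1]
  have h1 : perpDot k (bilinCoeff u u k) = perpDot k (galerkinQ S u k) := by
    rw [bilinCoeff_eq_galerkin hu]
    simp only [perpDot, PiLp.sub_apply, PiLp.smul_apply, modeVec_apply, smul_eq_mul]
    ring
  let F : Mode → ℂ := fun h => stream u h * stream u (k - h) * cross h k *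
    ((h 0 : ℂ) * (k 0 - h 0) + (h 1 : ℂ) * (k 1 - h 1))
  have hF : ∑ h ∈ interactions S k, F h = 0 := by
    -- All modes are used because `interactions` excludes `h = 0` but not `h = k`.
    rw [← tsum_eq_sum (L := SummationFilter.unconditional _) fun h hh => by simp [F, hz h hh]]
    refine tsum_eq_zero_of_odd (Equiv.subLeft k) fun h => ?_
    simp only [F, Equiv.subLeft_apply, sub_sub_cancel, cross_sub_self, Pi.sub_apply, Int.cast_sub]
    ring
  have hN : transport (stream u) k = ∑ h ∈ interactions S k,
      stream u h * stream u (k - h) * cross h k * normSq (k - h) :=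
    tsum_eq_sum fun h hh => by simp [hz h hh]
  rw [h1, galerkinQ, perpDot_sum_smul, ← add_zero (transport _ _), ← hF, hN,
    ← Finset.sum_add_distrib, Finset.mul_sum]
  refine Finset.sum_congr rfl fun h _ => ?_
  rw [dot_coeff, perpDot, coeff_apply_zero, coeff_apply_one, ofReal_normSq]
  simp only [F, Pi.sub_apply, Int.cast_sub]
  ring

/-! ### Evolution of the modes -/

theorem hasDerivAt_coeff {u : ℝ → PhaseSpace} {w : PhaseSpace} {t : ℝ} (h : HasDerivAt u w t)
    (k : Mode) : HasDerivAt (fun s => coeff (u s) k) (coeff w k) t :=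
  (((lp.evalCLM ℝ (fun _ : Mode => C2) 2 k).comp PhaseSpace.subtypeL).hasFDerivAt).comp_hasDerivAt
    t h

theorem hasDerivAt_stream {u : ℝ → PhaseSpace} {w : PhaseSpace} {t : ℝ} (h : HasDerivAt u w t)
    (k : Mode) : HasDerivAt (fun s => stream (u s) k) (stream w k) t := by
  have hp : ∀ i : Fin 2, HasDerivAt (fun s => coeff (u s) k i) (coeff w k i) t := fun i =>
    (((EuclideanSpace.proj i : C2 →L[ℂ] ℂ).restrictScalars ℝ).hasFDerivAt).comp_hasDerivAt t
      (hasDerivAt_coeff h k)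
  exact (((hp 0).const_mul _).add ((hp 1).const_mul _)).div_const _

theorem coeff_stokes (u : stokes.domain) (k : Mode) :
    coeff (stokes u) k = normSq k • coeff u k := rfl

theorem coeff_smul (r : ℝ) (u : PhaseSpace) (k : Mode) : coeff (r • u) k = r • coeff u k := rfl

theorem coeff_add (u v : PhaseSpace) (k : Mode) : coeff (u + v) k = coeff u k + coeff v k := rfl

/-- The stream function equation for a solution supported on finitely many shells. -/
theorem stream_equation {S : Finset ℝ} {g u w : PhaseSpace}
    (hu : ∀ k, normSq k ∉ S → coeff u k = 0) {k : Mode}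
    (h : coeff w k + normSq k • coeff u k + bilinCoeff u u k = coeff g k) :
    normSq k * stream w k = normSq k * stream g k - normSq k ^ 2 * stream u k -
      Complex.I * transport (stream u) k := by
  have h1 := congrArg (perpDot k) h
  have h2 : perpDot k (coeff w k + normSq k • coeff u k + bilinCoeff u u k) =
      perpDot k (coeff w k) + normSq k * perpDot k (coeff u k) + perpDot k (bilinCoeff u u k) := by
    simp only [perpDot, PiLp.add_apply, PiLp.smul_apply, Complex.real_smul]
    ring
  rw [h2, perpDot_bilinCoeff hu, perpDot_coeff, perpDot_coeff, perpDot_coeff] at h1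
  linear_combination h1

/-- A bounded solution on `ℝ` of `y' = a - r y`, `r > 0`, is the equilibrium. -/
theorem eq_equilibrium_of_bounded {y : ℝ → ℂ} {a : ℂ} {r C : ℝ} (hr : 0 < r)
    (hy : ∀ t, HasDerivAt y (a - r * y t) t) (hC : ∀ t, ‖y t‖ ≤ C) (t : ℝ) : y t = a / r := by
  have hr' : (r : ℂ) ≠ 0 := Complex.ofReal_ne_zero.2 hr.ne'
  let z : ℝ → ℂ := fun s => Real.exp (r * s) • (y s - a / r)
  have hz : ∀ s, HasDerivAt z 0 s := fun s => by
    have h1 : HasDerivAt (fun s => Real.exp (r * s)) (Real.exp (r * s) * (r * 1)) s :=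
      ((hasDerivAt_id s).const_mul r).exp
    have h2 := h1.smul ((hy s).sub_const (a / r))
    refine h2.congr_deriv ?_
    simp only [Complex.real_smul]
    push_cast
    field_simp
    ring
  have hconst : ∀ s, z s = z t := fun s =>
    is_const_of_deriv_eq_zero (fun s => (hz s).differentiableAt) (fun s => (hz s).deriv) s t
  -- Backward in time the integrating factor decays, so boundedness forces the constant `z` to
  -- vanish.
  have hlim : Filter.Tendsto (fun s => Real.exp (r * s) * (C + ‖a / r‖)) Filter.atBot
      (nhds (0 * (C + ‖a / r‖))) :=
    (Real.tendsto_exp_atBot.comp (Filter.tendsto_id.const_mul_atBot hr)).mul_const _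
  rw [zero_mul] at hlim
  have hle : ‖z t‖ ≤ 0 := by
    refine ge_of_tendsto hlim (Filter.Eventually.of_forall fun s => ?_)
    rw [← hconst s, norm_smul, Real.norm_of_nonneg (Real.exp_pos _).le]
    gcongr
    exact (norm_sub_le _ _).trans (by gcongr; exact hC s)
  have h0 : z t = 0 := norm_le_zero_iff.1 hle
  exact sub_eq_zero.1 ((smul_eq_zero.1 h0).resolve_left (Real.exp_pos _).ne')

theorem summable_norm_coeff_sq (u : PhaseSpace) : Summable fun k => ‖coeff u k‖ ^ 2 := by
  have h := (memℓp_gen_iff (p := 2) (by norm_num)).1 (lp.memℓp u.1)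
  simp only [ENNReal.toReal_ofNat, Real.rpow_ofNat] at h
  exact h

theorem norm_coeff_sq_le_energy (u : PhaseSpace) (k : Mode) :
    ‖coeff u k‖ ^ 2 ≤ energy u / (2 * Real.pi) ^ 2 := by
  rw [energy, mul_div_cancel_left₀ _ (by positivity)]
  exact (summable_norm_coeff_sq u).le_tsum k fun _ _ => sq_nonneg _

/-! ### Shells selected by the chained relation -/

theorem mem_shells {lam β α r : ℝ} :
    r ∈ shells lam β α ↔ r = lam ∨ r = muPlus β α ∨ r = muMinus β α := by
  simp [shells]

/-- Every real root of `μ² - α μ - β` is `μ₊` or `μ₋`. -/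
theorem eq_muPlus_or_eq_muMinus {β α r : ℝ} (h : r ^ 2 - α * r - β = 0) :
    r = muPlus β α ∨ r = muMinus β α := by
  -- A real root makes the discriminant a square, so `Real.sqrt` never takes its default value.
  have h1 : α ^ 2 + 4 * β = (2 * r - α) ^ 2 := by linear_combination -4 * h
  rw [muPlus, muMinus, h1, Real.sqrt_sq_eq_abs]
  rcases abs_cases (2 * r - α) with ⟨h2, -⟩ | ⟨h2, -⟩
  · left; rw [h2]; ring
  · right; rw [h2]; ring

theorem coeff_eq_zero_of_stokes_eq {lam : ℝ} {g : PhaseSpace}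
    (hg : ∃ h : g ∈ stokes.domain, stokes ⟨g, h⟩ = lam • g) {k : Mode} (hk : normSq k ≠ lam) :
    coeff g k = 0 := by
  obtain ⟨h, hA⟩ := hg
  have h1 := congrArg (fun v => coeff v k) hA
  simp only [coeff_stokes, coeff_smul] at h1
  rw [← sub_eq_zero, ← sub_smul] at h1
  exact (smul_eq_zero.1 h1).resolve_left (sub_ne_zero.2 hk)

theorem chain_root {g : PhaseSpace} {u : ℝ → PhaseSpace} {γ β α : ℝ}
    (hchain : ChainRelation g u γ β α) {k : Mode} (hgk : coeff g k = 0) {t : ℝ}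
    (hne : coeff (u t) k ≠ 0) : normSq k ^ 2 - α * normSq k - β = 0 := by
  obtain ⟨h₁, h₂, h⟩ := hchain t
  have h1 := congrArg (fun v => coeff v k) h
  simp only [coeff_stokes, coeff_smul, coeff_add, hgk, smul_zero, zero_add, smul_smul,
    ← add_smul] at h1
  rw [← sub_eq_zero, ← sub_smul] at h1
  linear_combination (smul_eq_zero.1 h1).resolve_right hne

theorem chain_support {lam : ℝ} {g : PhaseSpace}
    (hg : ∃ h : g ∈ stokes.domain, stokes ⟨g, h⟩ = lam • g)
    {u : ℝ → PhaseSpace} {γ β α : ℝ} (hchain : ChainRelation g u γ β α) {k : Mode}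
    (hk : normSq k ∉ shells lam β α) (t : ℝ) : coeff (u t) k = 0 := by
  rw [mem_shells, not_or] at hk
  by_contra hne
  exact hk.2 (eq_muPlus_or_eq_muMinus
    (chain_root hchain (coeff_eq_zero_of_stokes_eq hg hk.1) hne))

theorem IsSolution.exists_deriv {g : PhaseSpace} {u : ℝ → PhaseSpace} (hu : IsSolution g u)
    (t : ℝ) : ∃ w : PhaseSpace, HasDerivAt u w t ∧ ∀ k : Mode, k ≠ 0 →
      coeff w k + normSq k • coeff (u t) k + bilinCoeff (u t) (u t) k = coeff g k := by
  obtain ⟨ht, w, hw, h⟩ := hu t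
  exact ⟨w, hw, h⟩

theorem galerkin_system {S : Finset ℝ} {g : PhaseSpace} {u : ℝ → PhaseSpace}
    (hu : IsSolution g u) (hS : ∀ t k, normSq k ∉ S → coeff (u t) k = 0) (k : Mode) (t : ℝ) :
    HasDerivAt (fun s => coeff (u s) k)
      (coeff g k - normSq k • coeff (u t) k - (galerkinQ S (u t) k -
        (dot (galerkinQ S (u t) k) (modeVec k) / (normSq k : ℂ)) • modeVec k)) t := by
  obtain ⟨w, hw, h⟩ := hu.exists_deriv t
  refine (hasDerivAt_coeff hw k).congr_deriv ?_
  -- The equation is imposed only for `k ≠ 0`; at `k = 0` every term vanishes.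
  by_cases hk : k = 0
  · subst hk
    have h0 : modeVec 0 = 0 := by ext i; simp [modeVec_apply]
    have hQ : galerkinQ S (u t) 0 = 0 := by
      rw [galerkinQ]
      refine Finset.sum_eq_zero fun h _ => ?_
      simp [h0, dot]
    simp [h0, hQ, coeff_zero]
  · rw [← bilinCoeff_eq_galerkin (hS t), ← h k hk]
    abel

/-! ### Energy-enstrophy balance -/

theorem tsum_shells {S : Finset ℝ} {E : Type*} [AddCommMonoid E] [TopologicalSpace E]
    {f : Mode → E} (hf : ∀ k, normSq k ∉ S → f k = 0) :
    ∑' k, f k = ∑ k ∈ (finite_shell S).toFinset, f k :=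
  tsum_eq_sum fun k hk => hf k (by simpa using hk)

/-- Balance of enstrophy minus `λ` times energy for a ghost solution on finitely many shells. -/
theorem ghost_balance {S : Finset ℝ} {lam : ℝ} {g : PhaseSpace} {u : ℝ → PhaseSpace}
    (hg : ∀ k, normSq k ≠ lam → coeff g k = 0) (hu : IsGhost g u)
    (hS : ∀ t k, normSq k ∉ S → coeff (u t) k = 0) (t : ℝ) :
    ∑ k ∈ (finite_shell S).toFinset,
      (normSq k - lam) * (normSq k ^ 2 * ‖stream (u t) k‖ ^ 2) = 0 := by
  set T := (finite_shell S).toFinset with hTdef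
  have hT : ∀ k ∈ T, -k ∈ T := fun k hk => by simpa [hTdef, normSq_neg] using hk
  have hc : ∀ k ∉ T, stream (u t) k = 0 := fun k hk =>
    stream_eq_zero_of_coeff (hS t k (by simpa [hTdef] using hk))
  obtain ⟨w, hw, heq⟩ := hu.isSolution.exists_deriv t
  let X : ℝ → ℝ := fun s => ∑ k ∈ T, (normSq k - lam) * (normSq k * ‖stream (u s) k‖ ^ 2)
  have hX : X = fun s => ((2 * Real.pi) ^ 2)⁻¹ * (enstrophy (u s) - lam * energy (u s)) := by
    funext s
    rw [enstrophy, energy, tsum_shells (S := S) fun k hk => by rw [hS s k hk]; simp,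
      tsum_shells (S := S) fun k hk => by rw [hS s k hk]; simp]
    have hpi : (2 * Real.pi) ^ 2 ≠ 0 := by positivity
    rw [mul_left_comm lam, ← mul_sub, inv_mul_cancel_left₀ hpi, Finset.mul_sum,
      ← Finset.sum_sub_distrib]
    refine Finset.sum_congr rfl fun k _ => ?_
    rw [norm_coeff_sq]
    ring
  have hX0 : HasDerivAt X 0 t := by
    rw [hX]
    refine (((hu.enstrophy_deriv t).sub ((hu.energy_deriv t).const_mul lam)).const_mul
      _).congr_deriv ?_
    ring
  have hXC : (fun s => (X s : ℂ)) = fun s => ∑ k ∈ T, -((normSq k - lam : ℂ) * normSq k) *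
      (stream (u s) k * stream (u s) (-k)) := by
    funext s
    simp only [X]
    push_cast
    refine Finset.sum_congr rfl fun k _ => ?_
    have h1 := ofReal_norm_stream_sq (u s) k
    push_cast at h1
    rw [h1]
    ring
  have hX1 : HasDerivAt (fun s => (X s : ℂ)) (∑ k ∈ T, -((normSq k - lam : ℂ) * normSq k) *
      (stream w k * stream (u t) (-k) + stream (u t) k * stream w (-k))) t := by
    rw [hXC]
    exact HasDerivAt.fun_sum fun k _ =>
      ((hasDerivAt_stream hw k).mul (hasDerivAt_stream hw (-k))).const_mul _
  have h0 := hX1.unique hX0.ofReal_comp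
  -- Under `k ↦ -k` the two halves of the product rule agree.
  have hsymm : ∑ k ∈ T, -((normSq k - lam : ℂ) * normSq k) * (stream (u t) k * stream w (-k)) =
      ∑ k ∈ T, -((normSq k - lam : ℂ) * normSq k) * (stream w k * stream (u t) (-k)) := by
    refine Finset.sum_nbij' (fun k => -k) (fun k => -k) hT hT (fun _ _ => neg_neg _)
      (fun _ _ => neg_neg _) fun k _ => ?_
    rw [normSq_neg, neg_neg]
    ring
  simp only [mul_add, Finset.sum_add_distrib, hsymm, Complex.ofReal_zero] at h0
  have h1 : ∀ k, -((normSq k - lam : ℂ) * normSq k) * (stream w k * stream (u t) (-k)) =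
      Complex.I * (normSq k * transport (stream (u t)) k * stream (u t) (-k)) -
      Complex.I * lam * (transport (stream (u t)) k * stream (u t) (-k)) -
      (((normSq k - lam) * (normSq k ^ 2 * ‖stream (u t) k‖ ^ 2) : ℝ) : ℂ) := by
    intro k
    by_cases hk : k = 0
    · subst hk
      simp [stream_zero]
    have h2 := stream_equation (hS t) (heq k hk)
    -- The forcing drops out here; this is why the weight is `|k|² - λ`.
    have h3 : ((normSq k : ℂ) - lam) * stream g k = 0 := by
      by_cases hl : normSq k = lam
      · rw [hl, sub_self, zero_mul]
      · rw [stream_eq_zero_of_coeff (hg k hl), mul_zero]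
    have h4 := ofReal_norm_stream_sq (u t) k
    push_cast at h4 ⊢
    rw [h4]
    linear_combination -((normSq k : ℂ) - lam) * stream (u t) (-k) * h2 -
      normSq k * stream (u t) (-k) * h3
  simp only [h1, Finset.sum_sub_distrib, ← Finset.mul_sum, sum_transport hc hT,
    sum_normSq_transport hc hT, mul_zero, zero_sub, sub_zero, ← Complex.ofReal_sum] at h0
  have h5 : -(∑ k ∈ T, (normSq k - lam) * (normSq k ^ 2 * ‖stream (u t) k‖ ^ 2)) +
      -(∑ k ∈ T, (normSq k - lam) * (normSq k ^ 2 * ‖stream (u t) k‖ ^ 2)) = 0 := by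
    exact_mod_cast h0
  linarith

/-! ### Activity on both sides of the forcing shell -/

/-- A ghost solution does not stay on the shell of the forcing. -/
theorem exists_coeff_ne_zero_off_shell {lam : ℝ} (hlam : 0 < lam) {g : PhaseSpace}
    {u : ℝ → PhaseSpace} (hu : IsGhost g u) :
    ∃ t k, normSq k ≠ lam ∧ coeff (u t) k ≠ 0 := by
  by_contra! hsupp
  have hS : ∀ t k, normSq k ∉ ({lam} : Finset ℝ) → coeff (u t) k = 0 := fun t k hk =>
    hsupp t k (by simpa using hk)
  have henergy : ∀ t, energy (u t) = energy (u 0) := fun t =>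
    is_const_of_deriv_eq_zero (fun s => (hu.energy_deriv s).differentiableAt)
      (fun s => (hu.energy_deriv s).deriv) t 0
  have hconst : ∀ t k, stream (u t) k = stream (u 0) k := by
    intro t k
    by_cases hk : normSq k = lam
    swap
    · rw [stream_eq_zero_of_coeff (hsupp t k hk), stream_eq_zero_of_coeff (hsupp 0 k hk)]
    have hlam' : (lam : ℂ) ≠ 0 := Complex.ofReal_ne_zero.2 hlam.ne'
    have hk0 : k ≠ 0 := by
      rintro rfl
      rw [← hk] at hlam
      simp [normSq] at hlam
    have hy : ∀ s, HasDerivAt (fun s => stream (u s) k) (stream g k - lam * stream (u s) k) s := by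
      intro s
      obtain ⟨w, hw, heq⟩ := hu.isSolution.exists_deriv s
      refine (hasDerivAt_stream hw k).congr_deriv ?_
      have h1 := stream_equation (hS s) (heq k hk0)
      rw [transport_eq_zero_of_shell fun j hj => stream_eq_zero_of_coeff (hsupp s j hj), hk] at h1
      apply mul_left_cancel₀ hlam'
      linear_combination h1
    -- The constant energy bounds every mode uniformly in time.
    have hC : ∀ s, ‖stream (u s) k‖ ≤ √(energy (u 0) / (2 * Real.pi) ^ 2 / lam) := by
      intro s
      apply Real.le_sqrt_of_sq_le
      rw [le_div_iff₀ hlam, ← henergy s]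
      refine le_trans (le_of_eq ?_) (norm_coeff_sq_le_energy (u s) k)
      rw [norm_coeff_sq, hk, mul_comm]
    rw [eq_equilibrium_of_bounded hlam hy hC t, eq_equilibrium_of_bounded hlam hy hC 0]
  refine hu.nonstationary ⟨u 0, fun t => ?_⟩
  apply Subtype.ext
  apply Subtype.ext
  funext k
  exact coeff_eq_of_stream_eq (hconst t k)

/-- A vanishing weighted sum with a nonzero term has terms of both signs. -/
theorem exists_lt_and_exists_gt {ι : Type*} {T : Finset ι} {a b : ι → ℝ} (hb : ∀ i ∈ T, 0 ≤ b i)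
    (h : ∑ i ∈ T, a i * b i = 0) {j : ι} (hj : j ∈ T) (haj : a j ≠ 0) (hbj : b j ≠ 0) :
    (∃ i ∈ T, a i < 0 ∧ b i ≠ 0) ∧ ∃ i ∈ T, 0 < a i ∧ b i ≠ 0 := by
  constructor
  · by_contra! hneg
    refine mul_ne_zero haj hbj ((Finset.sum_eq_zero_iff_of_nonneg fun i hi => ?_).1 h j hj)
    rcases lt_or_ge (a i) 0 with h1 | h1
    · rw [hneg i hi h1, mul_zero]
    · exact mul_nonneg h1 (hb i hi)
  · by_contra! hpos
    refine mul_ne_zero haj hbj ((Finset.sum_eq_zero_iff_of_nonpos fun i hi => ?_).1 h j hj)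
    rcases lt_or_ge 0 (a i) with h1 | h1
    · rw [hpos i hi h1, mul_zero]
    · exact mul_nonpos_of_nonpos_of_nonneg h1 (hb i hi)

theorem muMinus_lt_and_lt_muPlus {β α lam r s : ℝ} (hr : r ^ 2 - α * r - β = 0)
    (hs : s ^ 2 - α * s - β = 0) (hrl : r < lam) (hls : lam < s) :
    0 < α ^ 2 + 4 * β ∧ muMinus β α < lam ∧ lam < muPlus β α := by
  have hle : muMinus β α ≤ muPlus β α := by
    rw [muMinus, muPlus]
    linarith [Real.sqrt_nonneg (α ^ 2 + 4 * β)]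
  have h1 : muMinus β α < lam := by
    rcases eq_muPlus_or_eq_muMinus hr with h | h <;> linarith
  have h2 : lam < muPlus β α := by
    rcases eq_muPlus_or_eq_muMinus hs with h | h <;> linarith
  -- The strict gap between `μ₋` and `μ₊` is the square root itself.
  refine ⟨Real.sqrt_pos.1 ?_, h1, h2⟩
  rw [muMinus] at h1
  rw [muPlus] at h2
  linarith

end GhostNSE

theorem mainTheorem7 (lam : ℝ) (hlam : 1 < lam) (g : GhostNSE.PhaseSpace)
    (hg : ∃ h : g ∈ GhostNSE.stokes.domain, GhostNSE.stokes ⟨g, h⟩ = lam • g)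
    (u : ℝ → GhostNSE.PhaseSpace) (hu : GhostNSE.IsChainedGhost g u)
    (γ β α : ℝ) (hchain : GhostNSE.ChainRelation g u γ β α) :
    0 < α ^ 2 + 4 * β ∧
    GhostNSE.muMinus β α < lam ∧ lam < GhostNSE.muPlus β α ∧
    (∀ k : GhostNSE.Mode, GhostNSE.normSq k ∈ GhostNSE.shells lam β α → ∀ t : ℝ,
      HasDerivAt (fun s => GhostNSE.coeff (u s) k)
        (GhostNSE.coeff g k - GhostNSE.normSq k • GhostNSE.coeff (u t) k -
          (GhostNSE.galerkinQ (GhostNSE.shells lam β α) (u t) k -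
            (GhostNSE.dot (GhostNSE.galerkinQ (GhostNSE.shells lam β α) (u t) k) (GhostNSE.modeVec k) /
              (GhostNSE.normSq k : ℂ)) • GhostNSE.modeVec k)) t) ∧
    (∀ k : GhostNSE.Mode, GhostNSE.normSq k ∉ GhostNSE.shells lam β α →
      ∀ t : ℝ, GhostNSE.coeff (u t) k = 0) ∧
    (∀ k : GhostNSE.Mode, GhostNSE.normSq k ≠ lam → GhostNSE.coeff g k = 0) := by
  open GhostNSE in
  have hgk : ∀ k, normSq k ≠ lam → coeff g k = 0 := fun k => coeff_eq_zero_of_stokes_eq hg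
  have hS : ∀ t k, normSq k ∉ shells lam β α → coeff (u t) k = 0 := fun t k hk =>
    chain_support hg hchain hk t
  have hroot : ∀ t k, normSq k ≠ lam → stream (u t) k ≠ 0 →
      normSq k ^ 2 - α * normSq k - β = 0 := fun t k hk hne =>
    chain_root hchain (hgk k hk) fun h => hne (stream_eq_zero_of_coeff h)
  obtain ⟨t, k, hk, hne⟩ := exists_coeff_ne_zero_off_shell (by linarith) hu.1
  have hk0 : k ≠ 0 := by
    rintro rfl
    exact hne (coeff_zero _)
  have hne' : stream (u t) k ≠ 0 := by
    have h1 := pow_ne_zero 2 (norm_ne_zero_iff.2 hne)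
    rw [norm_coeff_sq] at h1
    exact norm_ne_zero_iff.1 (pow_ne_zero_iff two_ne_zero |>.1 (right_ne_zero_of_mul h1))
  have hkT : k ∈ (finite_shell (shells lam β α)).toFinset := by
    rw [Set.Finite.mem_toFinset]
    by_contra h1
    exact hne (hS t k h1)
  obtain ⟨⟨i, -, hi, hi'⟩, ⟨j, -, hj, hj'⟩⟩ := exists_lt_and_exists_gt
    (fun i _ => by positivity) (ghost_balance hgk hu.1 hS t) hkT (sub_ne_zero.2 hk)
    (mul_ne_zero (pow_ne_zero 2 (normSq_pos hk0).ne')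
      (pow_ne_zero 2 (norm_ne_zero_iff.2 hne')))
  have hstream : ∀ j, normSq j ^ 2 * ‖stream (u t) j‖ ^ 2 ≠ 0 → stream (u t) j ≠ 0 := by
    intro j h1 h2
    simp [h2] at h1
  obtain ⟨h1, h2, h3⟩ := muMinus_lt_and_lt_muPlus
    (hroot t i (sub_ne_zero.1 hi.ne) (hstream i hi'))
    (hroot t j (sub_ne_zero.1 hj.ne') (hstream j hj')) (sub_neg.1 hi) (sub_pos.1 hj)
  exact ⟨h1, h2, h3, fun k _ t => galerkin_system hu.1.isSolution hS k t,
    fun k hk t => hS t k hk, hgk⟩
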